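/- For a function $u:\mathbb R\to\mathbb C$ let $$(-\Delta)^{1/2}u(x)=\frac1\pi\,\mathrm{p.v.}\!\int_{-\infty}^{\infty}\frac{u(x)-u(x+y)}{|y|^{2}}\,dy$$ (principal value at $y=0$). Fix $L>0$, and for $k\in\mathbb Z$ and $s\in(0,\pi)$ let $(-\Delta)_s^{1/2}e^{iks}$ denote the value at $x=L\cot s$ of $(-\Delta)^{1/2}$ applied to the function $x\mapsto e^{ik\,\mathrm{arccot}(x/L)}$, where $\mathrm{arccot}$ takes values in $(0,\pi)$. Let $M\ge 0$ be an integer, $a_0,\dots,a_M\in\mathbb C$, $s\in(0,\pi)$, and let $P$ be any integer with $P\ge 2M+1$. Let $\tilde b,\tilde c:\mathbb Z\to\mathbb C$ be the $P$-periodic sequences given by $$\tilde b_l=\begin{cases}(8l+4)a_l,&0\le l\le M,\\0,&M+1\le l\le P-1,\end{cases}\qquad \tilde c_l=\begin{cases}\frac13,&l=0,\\0,&1\le l\le P-M-1,\\ \dfrac1{(2(l-P)-3)(2(l-P)-1)(2(l-P)+1)},&P-M\le l\le P-1,\end{cases}$$ and let $(\tilde b*\tilde c)_l=\sum_{n=0}^{P-1}\tilde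 b_n\tilde c_{l-n}$ be their discrete cyclic convolution. Then the principal values defining $(-\Delta)_s^{1/2}e^{i(2l+1)s}$, $0\le l\le M$, exist, and $$\sum_{l=0}^{M}a_l(-\Delta)_s^{1/2}e^{i(2l+1)s}=-\frac{2i}{L\pi}\sum_{l=0}^{M}\frac{a_l}{2l+3}+\frac{2i}{L\pi}\sum_{l=0}^{M}(\tilde b*\tilde c)_l\,e^{2ils}-\frac{2i}{L\pi}\Big(\cos s+\sin^2 s\,\ln\cot\frac s2\Big)\sum_{l=0}^{M}(2l+1)a_l\,e^{i(2l+1)s}.$$ Moreover, with the discrete Fourier transform $\hat b_p=\sum_{l=0}^{P-1}b_l e^{-2\pi i lp/P}$ of $P$-periodic sequences, the convolution can be computed by discrete Fourier transforms of length $P$: $$(\tilde b*\tilde c)_l=\frac1P\sum_{p=0}^{P-1}\hat{\tilde b}_p\,\hat{\tilde c}_p\,e^{2\pi i lp/P},\qquad l\in\mathbb Z.$$ -/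

import Mathlib

open Filter Topology MeasureTheory

noncomputable section

namespace HalfLaplacian

/-- The normalizing constant
`c_α = α 2^(α-1) Γ(1/2 + α/2) / (√π Γ(1 - α/2))` of the one-dimensional fractional Laplacian. -/
def fracConst (α : ℝ) : ℝ :=
  α * (2 ^ (α - 1) * Real.Gamma (1 / 2 + α / 2)) / (Real.sqrt Real.pi * Real.Gamma (1 - α / 2))

/-- The integrand `(u(x) - u(x+y)) / |y|^(1+α)` as a function of `y`. -/
def fracIntegrand (α : ℝ) (u : ℝ → ℂ) (x y : ℝ) : ℂ :=
  (u x - u (x + y)) / ((|y| ^ (1 + α) : ℝ) : ℂ)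

/-- The fractional Laplacian at `x` with the symmetric neighbourhood `|y| ≤ ε` cut out. -/
def fracTruncated (α : ℝ) (u : ℝ → ℂ) (x ε : ℝ) : ℂ :=
  (fracConst α : ℂ) * ∫ y in {y : ℝ | ε < |y|}, fracIntegrand α u x y

/-- The principal value integral defining `(-Δ)^(α/2) u (x)` exists and has the value `v`. -/
def HasFracLaplacianAt (α : ℝ) (u : ℝ → ℂ) (x : ℝ) (v : ℂ) : Prop :=
  (∀ ε : ℝ, 0 < ε → IntegrableOn (fracIntegrand α u x) {y : ℝ | ε < |y|}) ∧
    Tendsto (fracTruncated α u x) (𝓝[>] 0) (𝓝 v)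

/-- The fractional Laplacian
`(-Δ)^(α/2) u (x) = c_α p.v. ∫ (u(x) - u(x+y)) / |y|^(1+α) dy` on `ℝ`
(meaningful when the principal value exists, see `HasFracLaplacianAt`). -/
def fracLaplacian (α : ℝ) (u : ℝ → ℂ) (x : ℝ) : ℂ :=
  limUnder (𝓝[>] 0) (fracTruncated α u x)

/-- The inverse cotangent with values in `(0, π)`. -/
def acot (x : ℝ) : ℝ := Real.pi / 2 - Real.arctan x

/-- A function of `s ∈ (0, π)`, seen as a function of `x ∈ ℝ` through `x = L cot s`. -/
def inX (L : ℝ) (f : ℝ → ℂ) (x : ℝ) : ℂ := f (acot (x / L))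

/-- `(-Δ)_s^(1/2) f (s)`: the half Laplacian in the variable `x = L cot s`. -/
def halfLaplacianS (L : ℝ) (f : ℝ → ℂ) (s : ℝ) : ℂ :=
  fracLaplacian 1 (inX L f) (L * Real.cot s)

/-- The principal value defining `(-Δ)_s^(1/2) f (s)` exists. -/
def HalfLaplacianSExists (L : ℝ) (f : ℝ → ℂ) (s : ℝ) : Prop :=
  HasFracLaplacianAt 1 (inX L f) (L * Real.cot s) (halfLaplacianS L f s)

/-- The function `s ↦ e^{iks}`. -/
def expMode (k : ℤ) (s : ℝ) : ℂ := Complex.exp (Complex.I * k * s)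

/-- The discrete cyclic convolution of two `P`-periodic sequences. -/
def cyclicConv (P : ℕ) (b c : ℤ → ℂ) (l : ℤ) : ℂ :=
  ∑ n ∈ Finset.range P, b n * c (l - n)

/-- The discrete Fourier transform of a `P`-periodic sequence. -/
def dft (P : ℕ) (b : ℤ → ℂ) (p : ℤ) : ℂ :=
  ∑ l ∈ Finset.range P, b l * Complex.exp (-(2 * Real.pi * Complex.I * l * p / P))

/-- The `P`-periodic extension of the values of `f` at `0, …, P - 1`. -/
def periodize (P : ℕ) (f : ℤ → ℂ) (l : ℤ) : ℂ := f (l % (P : ℤ))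

/-- The `P`-periodic sequence with `b̃_l = (8l+4) a_l` for `0 ≤ l ≤ M` and
`b̃_l = 0` for `M+1 ≤ l ≤ P-1`. -/
def bTilde (M P : ℕ) (a : ℕ → ℂ) : ℤ → ℂ :=
  periodize P fun l => if l ≤ M then (8 * (l : ℂ) + 4) * a l.toNat else 0

/-- The `P`-periodic sequence with `c̃_0 = 1/3`, `c̃_l = 0` for `1 ≤ l ≤ P-M-1` and
`c̃_l = 1 / ((2(l-P)-3) (2(l-P)-1) (2(l-P)+1))` for `P-M ≤ l ≤ P-1`. -/
def cTilde (M P : ℕ) : ℤ → ℂ :=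
  periodize P fun l =>
    if l = 0 then 1 / 3
    else if l ≤ (P : ℤ) - M - 1 then 0
    else 1 / ((2 * ((l : ℂ) - P) - 3) * (2 * ((l : ℂ) - P) - 1) * (2 * ((l : ℂ) - P) + 1))

end HalfLaplacian

end

namespace HalfLaplacian

open Complex

/-! Write `k = 2n+1` and `t = arccot((x+y)/L)`, so that `y = L (cot t - cot s)`. Integrating `(u(x)
- u(x+y))/y²` by parts leaves `u'(x+y)/y`, which in the variable `t` is `(i k sin s / L) e^{ikt} sin
t / sin(s-t) dt` on `(0, π)`. Subtracting the constant `c = e^{iks} sin s` from the numerator makes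
it divisible by `sin(s-t)`. The quotient is a trigonometric polynomial, whose primitive `R` gives
the algebraic terms (`exists_smoothPart`). The remainder `c / sin(s-t)` has primitive `-c
log|tan((s-t)/2)|`: its singularities cancel under symmetric truncation, and its values at `0` and
`π` give `ln cot(s/2)` (`hasFracLaplacianAt_inX_expMode`).

In the result for one mode, the coefficient of `e^{2ils}`, `l ≤ n`, is `2n+1` times a function of `l
- n`. Summation against `a_n` is therefore a convolution, and `P ≥ 2M+1` prevents aliasing when it
is made cyclic (`cTilde_sub`). The Fourier formula is the discrete convolution theorem
(`cyclicConv_eq_dft`). -/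

theorem fracConst_one : fracConst 1 = 1 / Real.pi := by
  have h : (1 : ℝ) - 1 / 2 = 1 / 2 := by norm_num
  rw [fracConst, h, Real.Gamma_one_half_eq, Real.mul_self_sqrt Real.pi_pos.le]
  norm_num

/-! ### Division of trigonometric polynomials by `sin(s-t)`. -/

theorem exp_mul_exp_mul_sin_sub (x y : ℂ) :
    exp (I * x) * exp (I * y) * Complex.sin (x - y) = (exp (I * x) ^ 2 - exp (I * y) ^ 2) / (2 * I) := by
  have h : exp (I * x) ≠ 0 := exp_ne_zero _
  have h' : exp (I * y) ≠ 0 := exp_ne_zero _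
  have e1 : exp (-(x - y) * I) = exp (I * y) / exp (I * x) := by
    rw [← exp_sub]; congr 1; ring
  have e2 : exp ((x - y) * I) = exp (I * x) / exp (I * y) := by
    rw [← exp_sub]; congr 1; ring
  rw [Complex.sin, e1, e2, mul_comm 2 I, ← div_div, div_I]
  field_simp
  ring

theorem exp_mul_sin (x : ℂ) : exp (I * x) * Complex.sin x = (exp (I * x) ^ 2 - 1) / (2 * I) := by
  simpa using exp_mul_exp_mul_sin_sub x 0

theorem exp_mul_cos (x : ℂ) : exp (I * x) * Complex.cos x = (exp (I * x) ^ 2 + 1) / 2 := by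
  have h := exp_mul_sin x
  have e : exp (I * x) = Complex.cos x + Complex.sin x * I := by rw [mul_comm, exp_mul_I]
  have e' : Complex.cos x = exp (I * x) - Complex.sin x * I := by rw [e]; ring
  rw [e', mul_sub, ← mul_assoc, h]
  have : I ≠ 0 := I_ne_zero
  field_simp
  ring

/-- `D` is the regular quotient left after removing the pole at `t = s`, and `R` is its primitive.
With `z = e^{it}` and `w = e^{is}`, the identity `(z²-1) w sin(s-t) = (w²-z²) sin t` gives the
recursion `D_{n+1} = w² D_n - w (z^{2n+3} - z^{2n+1})`, starting from `D_0 = -w z`. The end values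
follow the same recursion, with `z = 1` at `0` and `z = -1` at `π`. -/
theorem exists_smoothPart (s : ℝ) (n : ℕ) : ∃ R D : ℝ → ℂ,
    (∀ t, HasDerivAt R (D t) t) ∧
    (∀ t, D t * Complex.sin (s - t) =
      exp (I * t) ^ (2 * n + 1) * Complex.sin t - exp (I * s) ^ (2 * n + 1) * Complex.sin s) ∧
    Complex.sin s * (R Real.pi - R 0) = 2 * (-1 / ((2 * n + 1) * (2 * n + 3)) +
      (∑ l ∈ Finset.range (n + 1), 4 * exp (I * s) ^ (2 * l) /
        ((2 * ((l : ℂ) - n) - 3) * (2 * ((l : ℂ) - n) - 1) * (2 * ((l : ℂ) - n) + 1)))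
      - Complex.cos s * exp (I * s) ^ (2 * n + 1)) := by
  have hz (t : ℝ) : HasDerivAt (fun t : ℝ => exp (I * t)) (I * exp (I * t)) t := by
    have := ((hasDerivAt_id (t : ℂ)).const_mul I).cexp.comp_ofReal
    simpa [mul_comm] using this
  have hp : exp (I * Real.pi) = -1 := by rw [mul_comm, exp_pi_mul_I]
  induction n with
  | zero =>
    refine ⟨fun t => I * exp (I * s) * exp (I * t), fun t => - exp (I * s) * exp (I * t),
      fun t => ?_, fun t => ?_, ?_⟩
    · refine ((hz t).const_mul (I * exp (I * s))).congr_deriv ?_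
      linear_combination exp (I * s) * exp (I * t) * I_sq
    · have h0 := exp_mul_exp_mul_sin_sub s t
      simp only [mul_zero, zero_add, pow_one]
      linear_combination -h0 - exp_mul_sin t + exp_mul_sin s
    · have h0 := exp_mul_sin s
      have h1 := exp_mul_cos s
      rw [eq_div_iff (by simp)] at h0
      simp only [hp]
      norm_num
      linear_combination -h0 + 2 * h1
  | succ n ih =>
    obtain ⟨R, D, h1, h2, h3⟩ := ih
    have k1 : (2 * n + 1 : ℂ) ≠ 0 := by norm_cast
    have k3 : (2 * n + 3 : ℂ) ≠ 0 := by norm_cast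
    have k5 : (2 * n + 5 : ℂ) ≠ 0 := by norm_cast
    refine ⟨fun t => exp (I * s) ^ 2 * R t - exp (I * s) *
        (exp (I * t) ^ (2 * n + 3) / (I * (2 * n + 3)) -
          exp (I * t) ^ (2 * n + 1) / (I * (2 * n + 1))),
      fun t => exp (I * s) ^ 2 * D t - exp (I * s) *
        (exp (I * t) ^ (2 * n + 3) - exp (I * t) ^ (2 * n + 1)), fun t => ?_, fun t => ?_, ?_⟩
    · have e3 := ((hz t).pow (2 * n + 3)).div_const (I * (2 * n + 3))
      have e1 := ((hz t).pow (2 * n + 1)).div_const (I * (2 * n + 1))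
      refine (((h1 t).const_mul _).sub ((e3.sub e1).const_mul _)).congr_deriv ?_
      have : I ≠ 0 := I_ne_zero
      push_cast
      field_simp
      ring
    · have e : (exp (I * t) ^ 2 - 1) * exp (I * s) * Complex.sin (s - t) =
          (exp (I * s) ^ 2 - exp (I * t) ^ 2) * Complex.sin t := by
        apply mul_left_cancel₀ (exp_ne_zero (I * t))
        linear_combination (exp (I * t) ^ 2 - 1) * exp_mul_exp_mul_sin_sub s t -
          (exp (I * s) ^ 2 - exp (I * t) ^ 2) * exp_mul_sin t
      have := h2 t
      simp only [show 2 * (n + 1) + 1 = 2 * n + 3 by ring]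
      linear_combination exp (I * s) ^ 2 * this - exp (I * t) ^ (2 * n + 1) * e
    · have hs : 2 * I * Complex.sin s * exp (I * s) = exp (I * s) ^ 2 - 1 := by
        have h0 := exp_mul_sin s
        rw [eq_div_iff (by simp)] at h0
        linear_combination h0
      have hsum : ∑ l ∈ Finset.range (n + 1 + 1), 4 * exp (I * s) ^ (2 * l) /
          ((2 * ((l : ℂ) - (n + 1 : ℕ)) - 3) * (2 * ((l : ℂ) - (n + 1 : ℕ)) - 1) *
            (2 * ((l : ℂ) - (n + 1 : ℕ)) + 1)) =
          exp (I * s) ^ 2 * (∑ l ∈ Finset.range (n + 1), 4 * exp (I * s) ^ (2 * l) /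
            ((2 * ((l : ℂ) - n) - 3) * (2 * ((l : ℂ) - n) - 1) * (2 * ((l : ℂ) - n) + 1))) -
          4 / ((2 * n + 1) * (2 * n + 3) * (2 * n + 5)) := by
        -- The summands' denominators depend only on `l - n`, so shifting `l` by one multiplies by
        -- `w²`; the new `l = 0` term is what remains.
        rw [Finset.sum_range_succ', Finset.mul_sum,
          sub_eq_add_neg _ (4 / ((2 * (n : ℂ) + 1) * (2 * n + 3) * (2 * n + 5)))]
        congr 1
        · refine Finset.sum_congr rfl fun l _ => ?_
          push_cast
          rw [show ((l : ℂ) + 1 - (n + 1)) = l - n by ring]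
          ring
        · push_cast
          rw [← neg_div_neg_eq, neg_div]
          congr 2 <;> ring
      rw [hsum]
      have hp3 : (-1 : ℂ) ^ (2 * n + 3) = -1 := Odd.neg_one_pow ⟨n + 1, by ring⟩
      have hp1 : (-1 : ℂ) ^ (2 * n + 1) = -1 := Odd.neg_one_pow ⟨n, by ring⟩
      simp only [hp, hp3, hp1, ofReal_zero, mul_zero, exp_zero, one_pow]
      have key : Complex.sin s * (exp (I * s) * ((-1 / (I * (2 * n + 3)) - -1 / (I * (2 * n + 1))) -
          (1 / (I * (2 * n + 3)) - 1 / (I * (2 * n + 1))))) =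
          -2 * (exp (I * s) ^ 2 - 1) / ((2 * n + 1) * (2 * n + 3)) := by
        rw [← hs]
        have : I ≠ 0 := I_ne_zero
        field_simp
        ring_nf
        simp only [I_sq]
        ring
      have key2 : (-1 : ℂ) / ((2 * (n + 1 : ℕ) + 1) * (2 * (n + 1 : ℕ) + 3)) -
          4 / ((2 * n + 1) * (2 * n + 3) * (2 * n + 5)) = -1 / ((2 * n + 1) * (2 * n + 3)) := by
        push_cast
        rw [show (2 * ((n : ℂ) + 1) + 1) = 2 * n + 3 by ring,
          show (2 * ((n : ℂ) + 1) + 3) = 2 * n + 5 by ring]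
        field_simp
        ring
      simp only [show 2 * (n + 1) + 1 = 2 * n + 3 by ring]
      linear_combination exp (I * s) ^ 2 * h3 - key - 2 * key2

/-! ### The discrete convolution theorem. -/

theorem sum_exp_root (P : ℕ) (hP : 0 < P) (j : ℤ) :
    ∑ p ∈ Finset.range P, exp (2 * Real.pi * I * j * p / P) =
      if (P : ℤ) ∣ j then (P : ℂ) else 0 := by
  have hP' : (P : ℂ) ≠ 0 := by exact_mod_cast hP.ne'
  have hprim := Complex.isPrimitiveRoot_exp P hP.ne'
  have h (p : ℕ) : exp (2 * Real.pi * I * j * p / P) = (exp (2 * Real.pi * I / P) ^ j) ^ p := by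
    rw [← exp_int_mul, ← exp_nat_mul]
    congr 1
    ring
  simp only [h]
  split_ifs with hd
  · rw [(hprim.zpow_eq_one_iff_dvd j).2 hd]
    simp
  · have hne : exp (2 * Real.pi * I / P) ^ j ≠ 1 := fun e => hd ((hprim.zpow_eq_one_iff_dvd j).1 e)
    rw [geom_sum_eq hne, ← zpow_natCast, ← zpow_mul, mul_comm j, zpow_mul, zpow_natCast,
      hprim.pow_eq_one]
    simp

theorem periodize_emod (P : ℕ) (f : ℤ → ℂ) (l : ℤ) :
    periodize P f (l % (P : ℤ)) = periodize P f l := by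
  simp [periodize]

theorem cyclicConv_eq_dft (P : ℕ) (hP : 0 < P) (b c : ℤ → ℂ)
    (hc : ∀ l : ℤ, c (l % (P : ℤ)) = c l) (l : ℤ) :
    cyclicConv P b c l = 1 / P * ∑ p ∈ Finset.range P,
      dft P b p * dft P c p * exp (2 * Real.pi * I * l * p / P) := by
  have hP' : (P : ℂ) ≠ 0 := by exact_mod_cast hP.ne'
  have hPz : (0 : ℤ) < P := by exact_mod_cast hP
  have h1 (p : ℕ) : dft P b p * dft P c p * exp (2 * Real.pi * I * l * p / P) =
      ∑ m ∈ Finset.range P, ∑ n ∈ Finset.range P,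
        b m * c n * exp (2 * Real.pi * I * ((l - m - n : ℤ) : ℂ) * p / P) := by
    rw [dft, dft, Finset.sum_mul_sum, Finset.sum_mul]
    refine Finset.sum_congr rfl fun m _ => ?_
    rw [Finset.sum_mul]
    refine Finset.sum_congr rfl fun n _ => ?_
    rw [show 2 * Real.pi * I * ((l - m - n : ℤ) : ℂ) * p / P =
      -(2 * Real.pi * I * (m : ℤ) * (p : ℤ) / P) + -(2 * Real.pi * I * (n : ℤ) * (p : ℤ) / P) +
        2 * Real.pi * I * l * p / P by push_cast; ring, exp_add, exp_add]
    push_cast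
    ring
  simp only [h1]
  rw [Finset.sum_comm, Finset.mul_sum, cyclicConv]
  refine Finset.sum_congr rfl fun m _ => ?_
  rw [Finset.sum_comm]
  simp only [← Finset.mul_sum, sum_exp_root P hP]
  have hr0 := Int.emod_nonneg (l - m) hPz.ne'
  have hr1 := Int.emod_lt_of_pos (l - m) hPz
  -- Orthogonality of the characters keeps only the `n` in `[0, P)` congruent to `l - m`.
  rw [Finset.sum_eq_single ((l - m) % (P : ℤ)).toNat]
  · rw [Int.toNat_of_nonneg hr0, hc, if_pos (Int.dvd_self_sub_emod)]
    field_simp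
  · intro n hn hne
    rw [if_neg, mul_zero]
    rintro hd
    apply hne
    have : (n : ℤ) % P = (l - m) % P := 
      (Int.emod_eq_emod_iff_emod_sub_eq_zero.2 (Int.emod_eq_zero_of_dvd hd)).symm
    rw [Int.emod_eq_of_lt (by positivity) (by exact_mod_cast Finset.mem_range.1 hn)] at this
    omega
  · intro h
    exact absurd (Finset.mem_range.2 (by omega)) h

/-! ### The inverse cotangent. -/

theorem acot_mem_Ioo (v : ℝ) : acot v ∈ Set.Ioo 0 Real.pi := by
  have h1 := Real.arctan_lt_pi_div_two v
  have h2 := Real.neg_pi_div_two_lt_arctan v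
  constructor <;> rw [acot] <;> linarith

theorem sin_acot (v : ℝ) : Real.sin (acot v) = Real.cos (Real.arctan v) := by
  rw [acot, Real.sin_pi_div_two_sub]

theorem cos_acot (v : ℝ) : Real.cos (acot v) = Real.sin (Real.arctan v) := by
  rw [acot, Real.cos_pi_div_two_sub]

theorem cos_acot_eq (v : ℝ) : Real.cos (acot v) = v * Real.sin (acot v) := by
  rw [cos_acot, sin_acot]
  conv_rhs => rw [← Real.tan_arctan v, Real.arctan_tan (Real.neg_pi_div_two_lt_arctan v)
    (Real.arctan_lt_pi_div_two v)]
  rw [Real.tan_mul_cos (Real.cos_arctan_pos v).ne']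

theorem hasDerivAt_acot (v : ℝ) : HasDerivAt acot (-Real.sin (acot v) ^ 2) v := by
  rw [sin_acot, Real.cos_sq_arctan]
  exact (Real.hasDerivAt_arctan v).const_sub _

theorem acot_cot {s : ℝ} (hs : s ∈ Set.Ioo 0 Real.pi) : acot (Real.cot s) = s := by
  have h : Real.cot s = Real.tan (Real.pi / 2 - s) := by
    rw [Real.tan_pi_div_two_sub, Real.tan_eq_sin_div_cos, inv_div, Real.cot_eq_cos_div_sin]
  rw [acot, h, Real.arctan_tan] <;> linarith [hs.1, hs.2]

theorem tendsto_acot_atTop : Tendsto (fun v => acot v) atTop (𝓝 0) := by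
  simp only [acot]
  have h := (Real.tendsto_arctan_atTop.mono_right nhdsWithin_le_nhds).const_sub (Real.pi / 2)
  simpa using h

theorem tendsto_acot_atBot : Tendsto (fun v => acot v) atBot (𝓝 Real.pi) := by
  simp only [acot]
  have h := (Real.tendsto_arctan_atBot.mono_right nhdsWithin_le_nhds).const_sub (Real.pi / 2)
  simpa using h

/-! ### Truncated integrals and cancellation at the singularity. -/

theorem fracIntegrand_one (u : ℝ → ℂ) (x y : ℝ) :
    fracIntegrand 1 u x y = (u x - u (x + y)) / (y : ℂ) ^ 2 := by
  have h : |y| ^ (1 + 1 : ℝ) = y ^ 2 := by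
    rw [show (1 + 1 : ℝ) = (2 : ℕ) by norm_num, Real.rpow_natCast, sq_abs]
  rw [fracIntegrand, h, ofReal_pow]

theorem integrableOn_fracIntegrand_one {u : ℝ → ℂ} (hu : Continuous u) (C : ℝ)
    (hC : ∀ x, ‖u x‖ ≤ C) (x : ℝ) {ε : ℝ} (hε : 0 < ε) :
    IntegrableOn (fracIntegrand 1 u x) {y : ℝ | ε < |y|} := by
  have hm : MeasurableSet {y : ℝ | ε < |y|} := measurableSet_lt measurable_const measurable_id.abs
  have hb : Integrable fun y : ℝ => 2 * C * (1 + (ε ^ 2)⁻¹) * (1 + y ^ 2)⁻¹ :=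
    integrable_inv_one_add_sq.const_mul _
  refine Integrable.mono' hb.integrableOn ?_ ?_
  · have : Measurable (fracIntegrand 1 u x) := by
      simp only [funext (fracIntegrand_one u x)]
      have := hu.measurable
      fun_prop
    exact this.aestronglyMeasurable
  · refine (ae_restrict_iff' hm).2 (Eventually.of_forall fun y (hy : ε < |y|) => ?_)
    have hy2 : ε ^ 2 < y ^ 2 := by rw [← sq_abs y]; gcongr
    have hε2 : 0 < ε ^ 2 := by positivity
    have hy0 : 0 < y ^ 2 := hε2.trans hy2
    have hC0 : 0 ≤ C := (norm_nonneg _).trans (hC x)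
    rw [fracIntegrand_one, norm_div, norm_pow, norm_real, Real.norm_eq_abs, sq_abs]
    have h1 : ‖u x - u (x + y)‖ ≤ 2 * C := by
      linarith [norm_sub_le (u x) (u (x + y)), hC x, hC (x + y)]
    -- Away from `|y| ≤ ε` the kernel is dominated by a multiple of the integrable `1/(1+y²)`.
    have h2 : 1 / y ^ 2 ≤ (1 + (ε ^ 2)⁻¹) * (1 + y ^ 2)⁻¹ := by
      rw [← div_eq_mul_inv, div_le_div_iff₀ hy0 (by positivity)]
      have : 1 ≤ (ε ^ 2)⁻¹ * y ^ 2 := by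
        rw [inv_mul_eq_div, one_le_div hε2]; exact hy2.le
      linarith
    calc ‖u x - u (x + y)‖ / y ^ 2 ≤ 2 * C * (1 / y ^ 2) := by
          rw [div_eq_mul_one_div]; gcongr
      _ ≤ 2 * C * ((1 + (ε ^ 2)⁻¹) * (1 + y ^ 2)⁻¹) := by gcongr
      _ = _ := by ring

/-- The fundamental theorem of calculus for the truncated integral. -/
theorem fracTruncated_one_eq {u G : ℝ → ℂ} {x ε : ℝ} (hε : 0 < ε) {A B : ℂ}
    (hInt : IntegrableOn (fracIntegrand 1 u x) {y : ℝ | ε < |y|})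
    (hG : ∀ y ≠ 0, HasDerivAt G (fracIntegrand 1 u x y) y)
    (htop : Tendsto G atTop (𝓝 A)) (hbot : Tendsto G atBot (𝓝 B)) :
    fracTruncated 1 u x ε = 1 / Real.pi * (A - B + (G (-ε) - G ε)) := by
  have hset : {y : ℝ | ε < |y|} = Set.Iio (-ε) ∪ Set.Ioi ε := by
    ext y
    simp only [Set.mem_ofPred_eq, Set.mem_union, Set.mem_Iio, Set.mem_Ioi, lt_abs]
    constructor <;> rintro (h | h)
    · exact Or.inr h
    · left; linarith
    · right; linarith
    · exact Or.inl h
  rw [hset] at hInt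
  have hl := hInt.left_of_union
  have hr := hInt.right_of_union
  have hd : Disjoint (Set.Iio (-ε)) (Set.Ioi ε) := by
    rw [Set.disjoint_left]
    intro y (h1 : y < -ε) (h2 : ε < y)
    linarith
  have i1 := integral_Ioi_of_hasDerivAt_of_tendsto (hG ε hε.ne').continuousAt.continuousWithinAt
    (fun y hy => hG y (hε.trans hy).ne') hr htop
  have i2 := integral_Iic_of_hasDerivAt_of_tendsto
    (hG (-ε) (neg_ne_zero.2 hε.ne')).continuousAt.continuousWithinAt
    (fun y (hy : y < -ε) => hG y (hy.trans (neg_lt_zero.2 hε)).ne)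
    (integrableOn_Iic_iff_integrableOn_Iio (by simp) |>.2 hl) hbot
  rw [fracTruncated, fracConst_one, hset, setIntegral_union hd measurableSet_Ioi hl hr,
    ← integral_Iic_eq_integral_Iio, i1, i2]
  push_cast
  ring

theorem tendsto_slope_sub_slope {E : Type*} [NormedAddCommGroup E] [NormedSpace ℝ E]
    {f : ℝ → E} {f' : E} (hf : HasDerivAt f f' 0) :
    Tendsto (fun ε : ℝ => ε⁻¹ • (f ε - f 0)) (𝓝[>] 0) (𝓝 f') ∧
    Tendsto (fun ε : ℝ => ε⁻¹ • (f (-ε) - f 0)) (𝓝[>] 0) (𝓝 (-f')) := by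
  have h (g : ℝ → E) (g' : E) (hg : HasDerivAt g g' 0) :
      Tendsto (fun ε : ℝ => ε⁻¹ • (g ε - g 0)) (𝓝[>] 0) (𝓝 g') := by
    have := (hasDerivAt_iff_tendsto_slope_zero.1 hg).mono_left
      (nhdsWithin_mono (0 : ℝ) (s := Set.Ioi 0) fun y (hy : 0 < y) => hy.ne')
    simpa using this
  refine ⟨h f f' hf, ?_⟩
  have h0 : HasDerivAt f f' (-0) := by rwa [neg_zero]
  simpa using h (fun y => f (-y)) (-f') (by
    simpa [Function.comp_def] using h0.scomp (0 : ℝ) (hasDerivAt_neg 0))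

/-- Near a simple zero, the singularities of `log |τ|` on both sides cancel. -/
theorem tendsto_log_sub_log {τ : ℝ → ℝ} {τ' : ℝ} (h : HasDerivAt τ τ' 0) (h0 : τ 0 = 0)
    (h' : τ' ≠ 0) :
    Tendsto (fun ε : ℝ => Real.log (τ ε) - Real.log (τ (-ε))) (𝓝[>] 0) (𝓝 0) := by
  obtain ⟨h1, h2⟩ := tendsto_slope_sub_slope h
  have l1 := (Real.continuousAt_log h').tendsto.comp h1
  have l2 := (Real.continuousAt_log (neg_ne_zero.2 h')).tendsto.comp h2
  have := l1.sub l2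
  rw [Real.log_neg_eq_log, sub_self] at this
  refine this.congr' ?_
  filter_upwards [h1.eventually_ne h', h2.eventually_ne (neg_ne_zero.2 h'), self_mem_nhdsWithin]
    with ε e1 e2 (hε : 0 < ε)
  simp only [h0, sub_zero, smul_eq_mul, Function.comp] at e1 e2 ⊢
  rw [Real.log_mul (by positivity) (right_ne_zero_of_mul e1),
    Real.log_mul (by positivity) (right_ne_zero_of_mul e2)]
  ring

/-- Since `Real.log` is `log|·|`, one formula serves both sides of `t = s`. The endpoints `0` and
`π` are included because they are the limits of `t` as `y → ±∞`. -/
theorem hasDerivAt_log_tan_half {s t : ℝ} (hs : s ∈ Set.Ioo 0 Real.pi)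
    (ht : t ∈ Set.Icc 0 Real.pi) (hst : s ≠ t) :
    HasDerivAt (fun t : ℝ => Real.log (Real.tan ((s - t) / 2))) (-1 / Real.sin (s - t)) t := by
  have hc : Real.cos ((s - t) / 2) ≠ 0 :=
    (Real.cos_pos_of_mem_Ioo ⟨by linarith [hs.1, ht.2], by linarith [hs.2, ht.1]⟩).ne'
  have hsn : Real.sin ((s - t) / 2) ≠ 0 := by
    rw [Ne, Real.sin_eq_zero_iff_of_lt_of_lt (by linarith [hs.1, ht.2, Real.pi_pos])
      (by linarith [hs.2, ht.1, Real.pi_pos])]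
    intro h
    apply hst
    linarith
  have hd : HasDerivAt (fun t : ℝ => (s - t) / 2) (-1 / 2) t :=
    ((hasDerivAt_id t).const_sub s).div_const 2
  have ht' := (Real.hasDerivAt_tan hc).comp t hd
  refine (ht'.log ?_).congr_deriv ?_
  · simp only [Function.comp]
    rw [Real.tan_eq_sin_div_cos]
    exact div_ne_zero hsn hc
  · have e : Real.sin (s - t) = 2 * Real.sin ((s - t) / 2) * Real.cos ((s - t) / 2) := by
      rw [← Real.sin_two_mul]; congr 1; ring
    simp only [Function.comp]
    rw [e, Real.tan_eq_sin_div_cos]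
    field_simp

/-! ### The half Laplacian of a single odd mode. -/

theorem expMode_eq_pow (n : ℕ) (t : ℝ) : expMode n t = exp (I * t) ^ n := by
  rw [expMode, ← exp_nat_mul]
  congr 1
  push_cast
  ring

theorem hasDerivAt_expMode (k : ℤ) (t : ℝ) :
    HasDerivAt (expMode k) (I * k * expMode k t) t := by
  have := ((hasDerivAt_id (t : ℂ)).const_mul (I * k)).cexp.comp_ofReal
  refine (this.congr_deriv ?_ : HasDerivAt (fun t : ℝ => exp (I * k * t)) _ t)
  rw [expMode]
  simp only [id_eq, mul_one]
  ring

theorem norm_expMode (k : ℤ) (t : ℝ) : ‖expMode k t‖ = 1 := by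
  rw [expMode, show I * k * t = ((k * t : ℝ) : ℂ) * I by push_cast; ring, norm_exp_ofReal_mul_I]

theorem hasDerivAt_acot_div (L x y : ℝ) :
    HasDerivAt (fun y => acot ((x + y) / L)) (-Real.sin (acot ((x + y) / L)) ^ 2 / L) y := by
  have h : HasDerivAt (fun y : ℝ => (x + y) / L) (1 / L) y :=
    ((hasDerivAt_id y).const_add x).div_const L
  refine ((hasDerivAt_acot ((x + y) / L)).comp y h).congr_deriv ?_
  ring

theorem continuous_inX_expMode (L : ℝ) (k : ℤ) : Continuous (inX L (expMode k)) := by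
  refine continuous_iff_continuousAt.2 fun x => ?_
  have h := (hasDerivAt_acot_div L 0 x).continuousAt
  simp only [zero_add] at h
  exact ContinuousAt.comp (f := fun x => acot (x / L)) (hasDerivAt_expMode k _).continuousAt h

/-- The part of `t ↦ ∫ e^{ikt} sin t / sin (s - t) dt` that is singular at `t = s`,
together with a smooth remainder `R`. -/
noncomputable def primitive (s : ℝ) (c : ℂ) (R : ℝ → ℂ) (t : ℝ) : ℂ :=
  R t - c * (Real.log (Real.tan ((s - t) / 2)) : ℝ)

theorem hasFracLaplacianAt_inX_expMode {L : ℝ} (hL : 0 < L) {s : ℝ} (hs : s ∈ Set.Ioo 0 Real.pi)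
    (n : ℕ) {R D : ℝ → ℂ} (hR : ∀ t, HasDerivAt R (D t) t)
    (hD : ∀ t : ℝ, D t * Complex.sin (s - t) =
      exp (I * t) ^ (2 * n + 1) * Complex.sin t - exp (I * s) ^ (2 * n + 1) * Complex.sin s) :
    HasFracLaplacianAt 1 (inX L (expMode (2 * n + 1))) (L * Real.cot s)
      (I * (2 * n + 1) * Complex.sin s / (L * Real.pi) * (R Real.pi - R 0 -
        2 * exp (I * s) ^ (2 * n + 1) * Complex.sin s * (Real.log (Real.cot (s / 2)) : ℝ))) := by
  set k : ℤ := 2 * n + 1 with hk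
  have hkC : (k : ℂ) = 2 * n + 1 := by rw [hk]; push_cast; rfl
  have hkpow (t : ℝ) : expMode k t = exp (I * t) ^ (2 * n + 1) := by
    rw [← expMode_eq_pow, hk]; push_cast; rfl
  set x : ℝ := L * Real.cot s with hx
  set u : ℝ → ℂ := inX L (expMode k) with hu
  set T : ℝ → ℝ := fun y => acot ((x + y) / L) with hT
  set c : ℂ := exp (I * s) ^ (2 * n + 1) * Complex.sin s with hc
  set κ : ℂ := I * k * Complex.sin s / L with hκ
  have hLC : (L : ℂ) ≠ 0 := by exact_mod_cast hL.ne'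
  have hT0 : T 0 = s := by
    simp only [hT, hx, add_zero, mul_div_cancel_left₀ _ hL.ne', acot_cot hs]
  have hTmem (y : ℝ) : T y ∈ Set.Ioo 0 Real.pi := acot_mem_Ioo _
  have hTd (y : ℝ) : HasDerivAt T (-Real.sin (T y) ^ 2 / L) y := hasDerivAt_acot_div L x y
  have hss : 0 < Real.sin s := Real.sin_pos_of_mem_Ioo hs
  have hsT (y : ℝ) : 0 < Real.sin (T y) := Real.sin_pos_of_mem_Ioo (hTmem y)
  -- This is `y = L (cot t - cot s)` with denominators cleared; it turns `1/y` into `sin s sin t /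
  -- (L sin(s-t))`.
  have hy (y : ℝ) : y * (Real.sin s * Real.sin (T y)) = L * Real.sin (s - T y) := by
    have h1 : Real.cos (T y) = (x + y) / L * Real.sin (T y) := cos_acot_eq _
    have h2 : Real.cos (T 0) = (x + 0) / L * Real.sin (T 0) := cos_acot_eq _
    rw [hT0] at h2
    rw [Real.sin_sub, h1, h2]
    field_simp
    ring
  have hud (y : ℝ) : HasDerivAt (fun y => u (x + y))
      (-(I * k * expMode k (T y)) * Complex.sin (T y) ^ 2 / L) y := by
    refine ((hasDerivAt_expMode k (T y)).scomp y (hTd y)).congr_deriv ?_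
    rw [real_smul]
    push_cast
    ring
  have hsub (y : ℝ) (hy0 : y ≠ 0) : Real.sin (s - T y) ≠ 0 := by
    intro h
    have := hy y
    rw [h, mul_zero] at this
    exact mul_ne_zero hy0 (mul_pos hss (hsT y)).ne' this
  have hne (y : ℝ) (hy0 : y ≠ 0) : s ≠ T y := by
    intro h
    exact hsub y hy0 (by rw [← h, sub_self, Real.sin_zero])
  have hA {t : ℝ} (ht : t ∈ Set.Icc 0 Real.pi) (hst : s ≠ t) :
      HasDerivAt (primitive s c R) (D t + c / Complex.sin (s - t)) t := by
    refine ((hR t).sub ((hasDerivAt_log_tan_half hs ht hst).ofReal_comp.const_mul c)).congr_deriv ?_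
    push_cast
    ring
  -- Antiderivative of the integrand: the boundary term of the integration by parts, then the
  -- primitive of `-u'(x+y)/y` in the variable `t`.
  set G : ℝ → ℂ := fun y => -((u x - u (x + y)) / y) - κ * primitive s c R (T y) with hG
  have hGd (y : ℝ) (hy0 : y ≠ 0) : HasDerivAt G (fracIntegrand 1 u x y) y := by
    have hy0C : (y : ℂ) ≠ 0 := by exact_mod_cast hy0
    have d1 := (((hud y).const_sub (u x)).div (hasDerivAt_id y).ofReal_comp hy0C).neg
    have d2 := ((hA ⟨(hTmem y).1.le, (hTmem y).2.le⟩ (hne y hy0)).scomp y (hTd y)).const_mul κ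
    refine (d1.sub d2).congr_deriv ?_
    have hsC : Complex.sin (s - T y) ≠ 0 := by exact_mod_cast hsub y hy0
    have hssC : Complex.sin s ≠ 0 := by exact_mod_cast hss.ne'
    have hsTC : Complex.sin (T y) ≠ 0 := by exact_mod_cast (hsT y).ne'
    have hyC : (y : ℂ) * (Complex.sin s * Complex.sin (T y)) = L * Complex.sin (s - T y) := by
      exact_mod_cast hy y
    have e1 : D (T y) + c / Complex.sin (s - T y) =
        expMode k (T y) * Complex.sin (T y) / Complex.sin (s - T y) := by
      rw [eq_div_iff hsC, add_mul, hD, div_mul_cancel₀ _ hsC, hkpow]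
      ring
    rw [e1, fracIntegrand_one, real_smul, hκ]
    have e2 : Complex.sin (s - T y) = y * (Complex.sin s * Complex.sin (T y)) / L := by
      rw [hyC, mul_div_cancel_left₀ _ hLC]
    rw [e2]
    simp only [id_eq, ofReal_one]
    push_cast
    field_simp
    ring
  have hdiff (F : Filter ℝ) (hF : Tendsto (fun y : ℝ => |y|) F atTop) :
      Tendsto (fun y : ℝ => -((u x - u (x + y)) / (y : ℂ))) F (𝓝 0) := by
    have hb : Tendsto (fun y : ℝ => 2 * |y|⁻¹) F (𝓝 0) := by
      simpa using (tendsto_inv_atTop_zero.comp hF).const_mul (2 : ℝ)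
    refine squeeze_zero_norm (fun y => ?_) hb
    rw [norm_neg, norm_div, norm_real, Real.norm_eq_abs, div_eq_mul_inv]
    gcongr
    refine (norm_sub_le _ _).trans ?_
    simp only [hu, inX, norm_expMode]
    norm_num
  have hprim {t : ℝ} (ht : t ∈ Set.Icc 0 Real.pi) (hst : s ≠ t) {F : Filter ℝ}
      (hF : Tendsto T F (𝓝 t)) :
      Tendsto (fun y => κ * primitive s c R (T y)) F (𝓝 (κ * primitive s c R t)) :=
    ((hA ht hst).continuousAt.tendsto.comp hF).const_mul κ
  have hTtop : Tendsto T atTop (𝓝 0) :=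
    tendsto_acot_atTop.comp ((tendsto_atTop_add_const_left _ x tendsto_id).atTop_div_const hL)
  have hTbot : Tendsto T atBot (𝓝 Real.pi) :=
    tendsto_acot_atBot.comp ((tendsto_atBot_add_const_left _ x tendsto_id).atBot_div_const hL)
  have htop : Tendsto G atTop (𝓝 (0 - κ * primitive s c R 0)) :=
    (hdiff _ tendsto_abs_atTop_atTop).sub
      (hprim ⟨le_rfl, Real.pi_pos.le⟩ hs.1.ne' hTtop)
  have hbot : Tendsto G atBot (𝓝 (0 - κ * primitive s c R Real.pi)) :=
    (hdiff _ tendsto_abs_atBot_atTop).sub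
      (hprim ⟨Real.pi_pos.le, le_rfl⟩ hs.2.ne hTbot)
  have hInt (ε : ℝ) (hε : 0 < ε) : IntegrableOn (fracIntegrand 1 u x) {y : ℝ | ε < |y|} :=
    integrableOn_fracIntegrand_one (continuous_inX_expMode L k) 1
      (fun _ => (norm_expMode k _).le) x hε
  have hlog : Tendsto (fun ε : ℝ => Real.log (Real.tan ((s - T ε) / 2)) -
      Real.log (Real.tan ((s - T (-ε)) / 2))) (𝓝[>] 0) (𝓝 0) := by
    have d : HasDerivAt (fun y => (s - T y) / 2) (-(-Real.sin (T 0) ^ 2 / L) / 2) 0 :=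
      ((hTd 0).const_sub s).div_const 2
    have h0 : (s - T 0) / 2 = 0 := by rw [hT0, sub_self, zero_div]
    have d2 : HasDerivAt (fun y => Real.tan ((s - T y) / 2))
        (1 / Real.cos ((s - T 0) / 2) ^ 2 * (-(-Real.sin (T 0) ^ 2 / L) / 2)) 0 :=
      (Real.hasDerivAt_tan (by rw [h0, Real.cos_zero]; exact one_ne_zero)).comp (0 : ℝ) d
    refine tendsto_log_sub_log d2 (by rw [h0, Real.tan_zero]) ?_
    rw [h0, Real.cos_zero, hT0]
    have : 0 < Real.sin s ^ 2 / L := by positivity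
    have e : 1 / 1 ^ 2 * (-(-Real.sin s ^ 2 / L) / 2) = Real.sin s ^ 2 / L / 2 := by ring
    rw [e]
    positivity
  have hRT : Tendsto (fun ε : ℝ => R (T ε) - R (T (-ε))) (𝓝[>] 0) (𝓝 0) := by
    have h1 : ContinuousAt (fun y => R (T y) - R (T (-y))) 0 := by
      have hRc : Continuous R := continuous_iff_continuousAt.2 fun t => (hR t).continuousAt
      have hTc : Continuous T := continuous_iff_continuousAt.2 fun t => (hTd t).continuousAt
      fun_prop
    have h2 := h1.tendsto
    simp only [neg_zero, sub_self] at h2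
    exact h2.mono_left nhdsWithin_le_nhds
  -- The difference quotients at `±ε` tend to the same derivative and cancel; so do the logarithms,
  -- as `T` has nonzero derivative at `0`.
  have hrem : Tendsto (fun ε : ℝ => G (-ε) - G ε) (𝓝[>] 0) (𝓝 0) := by
    obtain ⟨s1, s2⟩ := tendsto_slope_sub_slope (hud 0)
    have h1 := ((s1.add s2).neg).add ((hRT.sub ((tendsto_ofReal_iff.2 hlog).const_mul c)).const_mul κ)
    simp only [add_neg_cancel, neg_zero, ofReal_zero, mul_zero, sub_zero, add_zero] at h1
    refine h1.congr' ?_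
    filter_upwards [self_mem_nhdsWithin] with ε (hε : 0 < ε)
    have hεC : (ε : ℂ) ≠ 0 := by exact_mod_cast hε.ne'
    simp only [hG, primitive, real_smul]
    push_cast
    field_simp
    ring
  refine ⟨hInt, ?_⟩
  have hlim := ((tendsto_const_nhds (x := (0 - κ * primitive s c R 0) -
    (0 - κ * primitive s c R Real.pi))).add hrem).const_mul (1 / (Real.pi : ℂ))
  have hval : 1 / (Real.pi : ℂ) * ((0 - κ * primitive s c R 0) -
      (0 - κ * primitive s c R Real.pi) + 0) =
      I * (2 * n + 1) * Complex.sin s / (L * Real.pi) * (R Real.pi - R 0 -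
        2 * exp (I * s) ^ (2 * n + 1) * Complex.sin s * (Real.log (Real.cot (s / 2)) : ℝ)) := by
    -- The logarithms at the two ends are opposite, whence the factor `2` in front of `log
    -- cot(s/2)`.
    have l0 : Real.log (Real.tan ((s - 0) / 2)) = -Real.log (Real.cot (s / 2)) := by
      rw [sub_zero, ← Real.log_inv, Real.cot_eq_cos_div_sin, inv_div, Real.tan_eq_sin_div_cos]
    have lπ : Real.log (Real.tan ((s - Real.pi) / 2)) = Real.log (Real.cot (s / 2)) := by
      rw [show (s - Real.pi) / 2 = -(Real.pi / 2 - s / 2) by ring, Real.tan_neg,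
        Real.log_neg_eq_log, Real.tan_pi_div_two_sub, Real.tan_eq_sin_div_cos, inv_div,
        Real.cot_eq_cos_div_sin]
    simp only [primitive, l0, lπ, hκ, hc, hkC]
    have hπ : (Real.pi : ℂ) ≠ 0 := by exact_mod_cast Real.pi_ne_zero
    push_cast
    field_simp
    ring
  rw [← hval]
  refine hlim.congr' ?_
  filter_upwards [self_mem_nhdsWithin] with ε (hε : 0 < ε)
  exact (fracTruncated_one_eq hε (hInt ε hε) hGd htop hbot).symm

/-- The half Laplacian of `e^{i(2n+1)s}`. -/
theorem hasFracLaplacianAt_inX_expMode_odd {L : ℝ} (hL : 0 < L) {s : ℝ}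
    (hs : s ∈ Set.Ioo 0 Real.pi) (n : ℕ) :
    HasFracLaplacianAt 1 (inX L (expMode (2 * n + 1))) (L * Real.cot s)
      (2 * I / (L * Real.pi) * (-1 / (2 * n + 3) +
        (∑ l ∈ Finset.range (n + 1), 4 * (2 * n + 1) /
          ((2 * ((l : ℂ) - n) - 3) * (2 * ((l : ℂ) - n) - 1) * (2 * ((l : ℂ) - n) + 1)) *
            expMode (2 * l) s) -
        ((Real.cos s + Real.sin s ^ 2 * Real.log (Real.cot (s / 2)) : ℝ) : ℂ) * (2 * n + 1) *
          expMode (2 * n + 1) s)) := by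
  obtain ⟨R, D, hR, hD, hv⟩ := exists_smoothPart s n
  have h := hasFracLaplacianAt_inX_expMode hL hs n hR hD
  convert h using 1
  have e1 : expMode (2 * n + 1) s = exp (I * s) ^ (2 * n + 1) := by
    rw [← expMode_eq_pow]; push_cast; rfl
  have e2 (l : ℕ) : expMode (2 * l) s = exp (I * s) ^ (2 * l) := by
    rw [← expMode_eq_pow]; push_cast; rfl
  have e3 : ∑ l ∈ Finset.range (n + 1), 4 * (2 * n + 1) /
      ((2 * ((l : ℂ) - n) - 3) * (2 * ((l : ℂ) - n) - 1) * (2 * ((l : ℂ) - n) + 1)) *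
        exp (I * s) ^ (2 * l) =
      (2 * n + 1) * ∑ l ∈ Finset.range (n + 1), 4 * exp (I * s) ^ (2 * l) /
        ((2 * ((l : ℂ) - n) - 3) * (2 * ((l : ℂ) - n) - 1) * (2 * ((l : ℂ) - n) + 1)) := by
    rw [Finset.mul_sum]
    exact Finset.sum_congr rfl fun l _ => by ring
  have e4 : (-1 : ℂ) / (2 * n + 3) = (2 * n + 1) * (-1 / ((2 * n + 1) * (2 * n + 3))) := by
    have k1 : (2 * n + 1 : ℂ) ≠ 0 := by norm_cast
    have k3 : (2 * n + 3 : ℂ) ≠ 0 := by norm_cast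
    field_simp
  simp only [e1, e2, e3]
  rw [e4]
  push_cast
  linear_combination (-(I * (2 * n + 1)) / (L * Real.pi)) * hv

theorem HasFracLaplacianAt.fracLaplacian_eq {α : ℝ} {u : ℝ → ℂ} {x : ℝ} {v : ℂ}
    (h : HasFracLaplacianAt α u x v) : fracLaplacian α u x = v :=
  h.2.limUnder_eq

/-! ### The cyclic convolution as a triangular sum. -/

theorem bTilde_of_le {M P : ℕ} (hP : 2 * M + 1 ≤ P) (a : ℕ → ℂ) {n : ℕ} (hn : n ≤ M) :
    bTilde M P a n = (8 * n + 4) * a n := by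
  have : (n : ℤ) % P = n := Int.emod_eq_of_lt (by omega) (by omega)
  simp [bTilde, periodize, this, hn]

theorem bTilde_of_lt {M P : ℕ} (a : ℕ → ℂ) {n : ℕ} (hn : M < n) (hnP : n < P) :
    bTilde M P a n = 0 := by
  have : (n : ℤ) % P = n := Int.emod_eq_of_lt (by omega) (by omega)
  simp [bTilde, periodize, this, hn]

/-- Negative differences wrap into `[P-M, P-1]`, while positive ones lie in `[1, M]`, inside the
zero block `[1, P-M-1]` exactly because `P ≥ 2M+1`. At `l = n` the formula gives `1/((-3)(-1)(1)) =
1/3`. -/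
theorem cTilde_sub {M P : ℕ} (hP : 2 * M + 1 ≤ P) {l n : ℕ} (hl : l ≤ M) (hn : n ≤ M) :
    cTilde M P (l - n) = if l ≤ n then
      1 / ((2 * ((l : ℂ) - n) - 3) * (2 * ((l : ℂ) - n) - 1) * (2 * ((l : ℂ) - n) + 1)) else 0 := by
  rcases lt_trichotomy l n with h | rfl | h
  · have e : ((l : ℤ) - n) % P = l - n + P := by
      rw [← Int.add_emod_right, Int.emod_eq_of_lt (by omega) (by omega)]
    simp only [cTilde, periodize, e]
    rw [if_neg (by omega), if_neg (by omega), if_pos h.le]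
    push_cast
    rw [add_sub_cancel_right]
  · simp [cTilde, periodize]
  · have e : ((l : ℤ) - n) % P = l - n := Int.emod_eq_of_lt (by omega) (by omega)
    simp only [cTilde, periodize, e]
    rw [if_neg (by omega), if_pos (by omega), if_neg (by omega)]

theorem cyclicConv_bTilde_cTilde {M P : ℕ} (hP : 2 * M + 1 ≤ P) (a : ℕ → ℂ) {l : ℕ} (hl : l ≤ M) :
    cyclicConv P (bTilde M P a) (cTilde M P) l = ∑ n ∈ Finset.range (M + 1), if l ≤ n then
      (8 * n + 4) * a n /
        ((2 * ((l : ℂ) - n) - 3) * (2 * ((l : ℂ) - n) - 1) * (2 * ((l : ℂ) - n) + 1)) else 0 := by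
  rw [cyclicConv]
  refine (Finset.sum_subset_zero_on_sdiff (Finset.range_mono (by omega)) (fun n hn => ?_)
    fun n hn => ?_).symm
  · simp only [Finset.mem_sdiff, Finset.mem_range] at hn
    rw [bTilde_of_lt a (by omega) hn.1, zero_mul]
  · have hn' : n ≤ M := Nat.lt_succ_iff.1 (Finset.mem_range.1 hn)
    rw [bTilde_of_le hP a hn', cTilde_sub hP hl hn']
    split_ifs
    · ring
    · ring

end HalfLaplacian

theorem mainTheorem2 (L : ℝ) (hL : 0 < L) (M : ℕ) (a : ℕ → ℂ) (s : ℝ)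
    (hs : s ∈ Set.Ioo 0 Real.pi) (P : ℕ) (hP : 2 * M + 1 ≤ P) :
    (∀ l ∈ Finset.range (M + 1),
      HalfLaplacian.HalfLaplacianSExists L (HalfLaplacian.expMode (2 * l + 1)) s) ∧
    (∑ l ∈ Finset.range (M + 1),
        a l * HalfLaplacian.halfLaplacianS L (HalfLaplacian.expMode (2 * l + 1)) s =
      -(2 * Complex.I / (L * Real.pi)) * ∑ l ∈ Finset.range (M + 1), a l / (2 * l + 3)
      + 2 * Complex.I / (L * Real.pi) *
          ∑ l ∈ Finset.range (M + 1),
            HalfLaplacian.cyclicConv P (HalfLaplacian.bTilde M P a) (HalfLaplacian.cTilde M P) l *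
              HalfLaplacian.expMode (2 * l) s
      - 2 * Complex.I / (L * Real.pi) *
          ((Real.cos s + Real.sin s ^ 2 * Real.log (Real.cot (s / 2)) : ℝ) : ℂ) *
          ∑ l ∈ Finset.range (M + 1),
            (2 * l + 1) * a l * HalfLaplacian.expMode (2 * l + 1) s) ∧
    (∀ l : ℤ,
      HalfLaplacian.cyclicConv P (HalfLaplacian.bTilde M P a) (HalfLaplacian.cTilde M P) l =
        1 / P * ∑ p ∈ Finset.range P,
          HalfLaplacian.dft P (HalfLaplacian.bTilde M P a) p *
            HalfLaplacian.dft P (HalfLaplacian.cTilde M P) p *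
            Complex.exp (2 * Real.pi * Complex.I * l * p / P)) := by
  have hv (l : ℕ) := HalfLaplacian.hasFracLaplacianAt_inX_expMode_odd hL hs l
  refine ⟨fun l _ => ?_, ?_, fun l => ?_⟩
  · rw [HalfLaplacian.HalfLaplacianSExists, HalfLaplacian.halfLaplacianS, (hv l).fracLaplacian_eq]
    exact hv l
  · have hconv : ∑ l ∈ Finset.range (M + 1),
        HalfLaplacian.cyclicConv P (HalfLaplacian.bTilde M P a) (HalfLaplacian.cTilde M P) l *
          HalfLaplacian.expMode (2 * l) s = ∑ n ∈ Finset.range (M + 1), a n *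
        ∑ l ∈ Finset.range (n + 1), 4 * (2 * n + 1) /
          ((2 * ((l : ℂ) - n) - 3) * (2 * ((l : ℂ) - n) - 1) * (2 * ((l : ℂ) - n) + 1)) *
            HalfLaplacian.expMode (2 * l) s := by
      have h1 : ∀ l ∈ Finset.range (M + 1),
          HalfLaplacian.cyclicConv P (HalfLaplacian.bTilde M P a) (HalfLaplacian.cTilde M P) l *
            HalfLaplacian.expMode (2 * l) s = ∑ n ∈ Finset.range (M + 1), if l ≤ n then
          a n * (4 * (2 * n + 1) /
            ((2 * ((l : ℂ) - n) - 3) * (2 * ((l : ℂ) - n) - 1) * (2 * ((l : ℂ) - n) + 1)) *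
              HalfLaplacian.expMode (2 * l) s) else 0 := fun l hl => by
        rw [HalfLaplacian.cyclicConv_bTilde_cTilde hP a (Nat.lt_succ_iff.1 (Finset.mem_range.1 hl)),
          Finset.sum_mul]
        refine Finset.sum_congr rfl fun n _ => ?_
        split_ifs
        · ring
        · ring
      -- Exchanging the sums over `l ≤ n ≤ M` regroups the convolution by mode `n`, matching the
      -- single-mode formula.
      rw [Finset.sum_congr rfl h1, Finset.sum_comm]
      refine Finset.sum_congr rfl fun n hn => ?_
      have hnM := Finset.mem_range.1 hn
      rw [← Finset.sum_filter, Finset.mul_sum]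
      refine Finset.sum_congr ?_ fun _ _ => rfl
      ext l
      simp only [Finset.mem_filter, Finset.mem_range]
      omega
    rw [hconv]
    simp only [Finset.mul_sum (Finset.range (M + 1))]
    rw [← Finset.sum_add_distrib, ← Finset.sum_sub_distrib]
    refine Finset.sum_congr rfl fun n _ => ?_
    rw [HalfLaplacian.halfLaplacianS, (hv n).fracLaplacian_eq]
    ring
  · exact HalfLaplacian.cyclicConv_eq_dft P (by omega) _ _
      (HalfLaplacian.periodize_emod P _) l
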